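/- Let $\mathbf{k}$ be a field of characteristic different from $2$ and let $n\ge 1$. Put $F_n=\mathbf{k}(a_1,\ldots,a_n)$, the field of rational functions, and $E_n=\mathbf{k}(\sqrt{a_1},\ldots,\sqrt{a_n})$. Let ${\rm K}_2^\bullet(F)={\rm K}^\bullet_{\rm Mil}(F)/2$ denote the Milnor K-ring of a field $F$ modulo $2$, write $\{a\}$ for the class of $a\in F^*$ in degree $1$, $\{a_1,\ldots,a_r\}=\{a_1\}\cdots\{a_r\}$, and $\varepsilon=\{-1\}$. For $d_1,\ldots,d_m\in F^*$ let $\sigma_i(d_1,\ldots,d_m)\in{\rm K}_2^i(F)$ be the $i$-th elementary symmetric polynomial in $\{d_1\},\ldots,\{d_m\}$. Let $\sigma_i(a_1,\ldots,a_1\cdots a_n)\in {\rm K}_2^i(F_n)$ be $\sigma_i$ of the family of the $2^n-1$ products $\prod_{j\in I}a_j$, $\emptyset\ne I\subseteq\{1,\ldots,n\}$. Then \[ \sigma_i(a_1,\ldots,a_1\cdots a_n)=\begin{cases} 1 & i=0,\\ 0 & i\ne 0,\,2^{n-1},\\ \displaystyle\varepsilon^{2^{n-1}-n}\{a_1,\ldots,a_n\}+\sum_{\emptyset\ne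 J\subsetneq\{1,\ldots,n\}}\varepsilon^{2^{n-1}-|J|}\prod_{j\in J}\{a_j\} & i=2^{n-1}. \end{cases} \] (In the last line every term of the sum has a strictly higher power of $\varepsilon$ than the leading term.) Consequently the Galois--Stiefel--Whitney classes $\alpha_i(E_n)\in{\rm K}_2^i(F_n)$ of the étale algebra $E_n/F_n$ are given by the same formulas: \[ \alpha_i(E_n)=\begin{cases} 1 & i=0,\\ 0 & i\ne 0,\,2^{n-1},\\ \displaystyle\varepsilon^{2^{n-1}-n}\{a_1,\ldots,a_n\}+\sum_{\emptyset\ne J\subsetneq\{1,\ldots,n\}}\varepsilon^{2^{n-1}-|J|}\prod_{j\in J}\{a_j\} & i=2^{n-1}. \end{cases} \] Here, for an étale algebra $E$ of rank $m$ over a field $F$ of characteristic different from $2$, $\alpha_i^{\rm SW}(E)=\sigma_i(d_1,\ldots,d_m)$, where $\langle d_1,\ldots,d_m\rangle$ is any diagonalization of the trace form $x\mapsto{\rm tr}_{E/F}(x^2)$, and $\alpha_i(E)=\alpha_i^{\rm SW}(E)$ for $i$ odd, $\alpha_i(E)=\alpha_i^{\rm SW}(E)+\{2\}\cdot\alpha_{i-1}^{\rm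 SW}(E)$ for $i$ even (with $\alpha^{\rm SW}_{-1}=0$). -/

import Mathlib

noncomputable section

namespace MultiquadraticSW

universe u v

/-! Milnor K-theory of a field, and its reduction modulo two. -/

/-- The defining relations of the Milnor K-ring, imposed on the tensor algebra over `ℤ` of the
multiplicative group: `a₁ ⊗ ⋯ ⊗ a_r = 0` whenever `r > 0` and `a₁ + ⋯ + a_r = 1`. -/
inductive SteinbergRel (F : Type u) [Field F] :
    TensorAlgebra ℤ (Additive Fˣ) → TensorAlgebra ℤ (Additive Fˣ) → Prop
  | of (l : List Fˣ) (hl : l ≠ []) (hsum : (l.map fun a => (a : F)).sum = 1) :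
      SteinbergRel F
        (l.map fun a => TensorAlgebra.ι ℤ (Additive.ofMul a)).prod 0

/-- The Milnor K-ring of `F` (the direct sum of all its graded pieces). -/
def MilnorK (F : Type u) [Field F] : Type u := RingQuot (SteinbergRel F)

instance (F : Type u) [Field F] : Ring (MilnorK F) :=
  inferInstanceAs (Ring (RingQuot (SteinbergRel F)))

/-- The relation `2 = 0` on the Milnor K-ring. -/
inductive TwoRel (F : Type u) [Field F] : MilnorK F → MilnorK F → Prop
  | two : TwoRel F 2 0

/-- The Milnor K-ring of `F` modulo two. -/
def MilnorK2 (F : Type u) [Field F] : Type u := RingQuot (TwoRel F)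

instance (F : Type u) [Field F] : Ring (MilnorK2 F) :=
  inferInstanceAs (Ring (RingQuot (TwoRel F)))

/-- The projection from the tensor algebra to the Milnor K-ring. -/
def toMilnorK (F : Type u) [Field F] : TensorAlgebra ℤ (Additive Fˣ) →+* MilnorK F :=
  RingQuot.mkRingHom (SteinbergRel F)

/-- Reduction modulo two. -/
def modTwo (F : Type u) [Field F] : MilnorK F →+* MilnorK2 F :=
  RingQuot.mkRingHom (TwoRel F)

/-- The symbol `{a}`, an element of degree one. -/
def symb {F : Type u} [Field F] (a : Fˣ) : MilnorK2 F :=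
  modTwo F (toMilnorK F (TensorAlgebra.ι ℤ (Additive.ofMul a)))

section Comm

variable {F : Type u} [Field F]

theorem toMilnorK_surjective : Function.Surjective (toMilnorK F) :=
  RingQuot.mkRingHom_surjective (SteinbergRel F)

theorem modTwo_surjective : Function.Surjective (modTwo F) :=
  RingQuot.mkRingHom_surjective (TwoRel F)

theorem MilnorK2.two_eq_zero : (2 : MilnorK2 F) = 0 := by
  have h : modTwo F 2 = modTwo F 0 := RingQuot.mkRingHom_rel TwoRel.two
  rwa [map_zero, map_ofNat] at h

theorem symb_mul (a b : Fˣ) : symb (a * b) = symb a + symb b := by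
  simp [symb, ofMul_mul]

theorem symb_one : symb (1 : Fˣ) = 0 := by
  simp [symb]

theorem symb_steinberg (a b : Fˣ) (h : (a : F) + b = 1) : symb a * symb b = 0 := by
  have h1 : toMilnorK F ([a, b].map fun a => TensorAlgebra.ι ℤ (Additive.ofMul a)).prod =
      toMilnorK F 0 :=
    RingQuot.mkRingHom_rel (SteinbergRel.of [a, b] (by simp) (by simpa using h))
  have h2 := congrArg (modTwo F) h1
  simpa [symb] using h2

theorem symb_mul_neg (a : Fˣ) : symb a * symb (-a) = 0 := by
  by_cases ha : (a : F) = 1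
  · have : a = 1 := Units.ext ha
    rw [this, symb_one, zero_mul]
  · have h1 : (1 : F) - a ≠ 0 := fun h => ha (sub_eq_zero.mp h).symm
    have h2 : (1 : F) - (a : F)⁻¹ ≠ 0 := by
      intro h
      apply ha
      have := (sub_eq_zero.mp h).symm
      rwa [inv_eq_one] at this
    have e1 := symb_steinberg a (Units.mk0 _ h1) (by simp)
    have e2 := symb_steinberg a⁻¹ (Units.mk0 _ h2) (by simp)
    have e3 : Units.mk0 _ h1 = (-a) * Units.mk0 _ h2 := by
      ext
      simp [mul_sub]
    have e4 : symb a⁻¹ = -symb a := by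
      have := symb_mul a a⁻¹
      rw [mul_inv_cancel, symb_one] at this
      exact (neg_eq_of_add_eq_zero_right this.symm).symm
    rw [e3, symb_mul, mul_add] at e1
    rw [e4, neg_mul, neg_eq_zero] at e2
    rwa [e2, add_zero] at e1

theorem symb_comm (a b : Fˣ) : symb a * symb b = symb b * symb a := by
  have h := symb_mul_neg (a * b)
  have h1 : symb (-(a * b)) = symb (-a) + symb b := by rw [← symb_mul, neg_mul]
  have h2 : symb (-(a * b)) = symb (-b) + symb a := by rw [← symb_mul, neg_mul, mul_comm]
  rw [symb_mul, add_mul] at h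
  nth_rewrite 1 [h1] at h
  rw [h2, mul_add, mul_add, symb_mul_neg, symb_mul_neg, zero_add, zero_add] at h
  have h3 : symb b * symb a + symb b * symb a = 0 := by
    rw [← two_mul, MilnorK2.two_eq_zero, zero_mul]
  exact add_right_cancel (h.trans h3.symm)

theorem MilnorK2.mul_comm' (x y : MilnorK2 F) : x * y = y * x := by
  obtain ⟨x, rfl⟩ := modTwo_surjective x
  obtain ⟨x, rfl⟩ := toMilnorK_surjective x
  obtain ⟨y, rfl⟩ := modTwo_surjective y
  obtain ⟨y, rfl⟩ := toMilnorK_surjective y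
  change Commute (modTwo F (toMilnorK F x)) (modTwo F (toMilnorK F y))
  induction x using TensorAlgebra.induction with
  | algebraMap r =>
    rw [eq_intCast, map_intCast, map_intCast]
    exact Int.cast_commute _ _
  | ι m =>
    induction y using TensorAlgebra.induction with
    | algebraMap r =>
      rw [eq_intCast, map_intCast, map_intCast]
      exact Int.commute_cast _ _
    | ι m' => exact symb_comm m.toMul m'.toMul
    | mul y z hy hz => rw [map_mul, map_mul]; exact hy.mul_right hz
    | add y z hy hz => rw [map_add, map_add]; exact hy.add_right hz
  | mul x z hx hz => rw [map_mul, map_mul]; exact hx.mul_left hz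
  | add x z hx hz => rw [map_add, map_add]; exact hx.add_left hz

end Comm

/-- Modulo two the graded-commutative Milnor K-ring is commutative. -/
instance (F : Type u) [Field F] : CommRing (MilnorK2 F) :=
  { (inferInstance : Ring (MilnorK2 F)) with mul_comm := MilnorK2.mul_comm' }

/-- `ε = {-1}`. -/
def eps (F : Type u) [Field F] : MilnorK2 F := symb (-1)

/-- The `i`-th elementary symmetric polynomial of a finite family of units, seen in degree `i` of
the Milnor K-ring modulo two: the sum over all `i`-element subsets `S` of the index set of the
products of the symbols `{d s}`, `s ∈ S`. -/
def sigma {F : Type u} [Field F] {ι : Type v} [Fintype ι] (i : ℕ) (d : ι → Fˣ) : MilnorK2 F :=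
  ∑ S ∈ Finset.powersetCard i Finset.univ, ∏ s ∈ S, symb (d s)

section WellDefined

variable {F : Type u} [Field F] {ι : Type v} [Fintype ι]

theorem MilnorK2.add_self (x : MilnorK2 F) : x + x = 0 := by
  rw [← two_mul, MilnorK2.two_eq_zero, zero_mul]

theorem symb_sq_mul (x d : Fˣ) : symb (x ^ 2 * d) = symb d := by
  rw [symb_mul, pow_two, symb_mul, MilnorK2.add_self, zero_add]

theorem symb_inv (a : Fˣ) : symb a⁻¹ = symb a := by
  have h := symb_sq_mul a a⁻¹
  rwa [pow_two, mul_inv_cancel_right, eq_comm] at h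

/-- The generating polynomial of the classes `sigma i d`. -/
def sigmaPoly (d : ι → Fˣ) : Polynomial (MilnorK2 F) :=
  ∏ i, (1 + Polynomial.C (symb (d i)) * Polynomial.X)

theorem coeff_sigmaPoly (d : ι → Fˣ) (n : ℕ) : (sigmaPoly d).coeff n = sigma n d := by
  classical
  rw [sigmaPoly, Finset.prod_one_add, Polynomial.finsetSum_coeff, sigma,
    Finset.powersetCard_eq_filter, Finset.sum_filter]
  refine Finset.sum_congr rfl fun S _ => ?_
  rw [Finset.prod_mul_distrib, Finset.prod_const, ← map_prod, Polynomial.coeff_C_mul_X_pow]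
  simp [eq_comm]

theorem sigmaPoly_update [DecidableEq ι] (d : ι → Fˣ) (i : ι) (a : Fˣ) (h : symb a = symb (d i)) :
    sigmaPoly (Function.update d i a) = sigmaPoly d := by
  refine Finset.prod_congr rfl fun j _ => ?_
  by_cases hj : j = i
  · subst hj; simp [h]
  · simp [hj]

theorem sigmaPoly_update_two [DecidableEq ι] (d : ι → Fˣ) {i j : ι} (hij : i ≠ j) (a b : Fˣ)
    (h1 : symb a + symb b = symb (d i) + symb (d j))
    (h2 : symb a * symb b = symb (d i) * symb (d j)) :
    sigmaPoly (Function.update (Function.update d i a) j b) = sigmaPoly d := by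
  have key : ∀ e : ι → Fˣ, sigmaPoly e =
      ((1 + Polynomial.C (symb (e i)) * Polynomial.X) *
        (1 + Polynomial.C (symb (e j)) * Polynomial.X)) *
      ∏ l ∈ (Finset.univ.erase i).erase j, (1 + Polynomial.C (symb (e l)) * Polynomial.X) := by
    intro e
    rw [sigmaPoly, ← Finset.mul_prod_erase Finset.univ _ (Finset.mem_univ i),
      ← Finset.mul_prod_erase (Finset.univ.erase i) _
        (Finset.mem_erase.mpr ⟨hij.symm, Finset.mem_univ j⟩), mul_assoc]
  rw [key, key d]
  congr 1
  · simp only [Function.update_self, Function.update_of_ne hij]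
    have h1' := congrArg (Polynomial.C (R := MilnorK2 F)) h1
    have h2' := congrArg (Polynomial.C (R := MilnorK2 F)) h2
    simp only [map_add, map_mul] at h1' h2'
    linear_combination Polynomial.X * h1' + Polynomial.X ^ 2 * h2'
  · refine Finset.prod_congr rfl fun l hl => ?_
    simp only [Finset.mem_erase] at hl
    simp [hl.1, hl.2.1]

theorem symb_binary (a b w : Fˣ) (h : (a : F) + b = w) :
    symb a * symb b = symb w * symb (a * b * w) := by
  have h1 := symb_steinberg (a * w⁻¹) (b * w⁻¹) (by
    push_cast
    rw [← add_mul, h]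
    exact mul_inv_cancel₀ w.ne_zero)
  rw [symb_mul, symb_mul, symb_inv] at h1
  rw [symb_mul, symb_mul]
  linear_combination h1 - MilnorK2.add_self (symb w * (symb a + symb b + symb w))

variable {V : Type*} [AddCommGroup V] [Module F V]

/-- An orthogonal family `b` with values `d`. -/
def OrthFamily (B : LinearMap.BilinForm F V) (b : ι → V) (d : ι → Fˣ) : Prop :=
  (∀ i j, i ≠ j → B (b i) (b j) = 0) ∧ ∀ i, B (b i) (b i) = d i

theorem OrthFamily.update_two [DecidableEq ι] {B : LinearMap.BilinForm F V} (hB : B.IsSymm)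
    {b : ι → V} {d : ι → Fˣ} (h : OrthFamily B b d) {i j : ι} (hij : i ≠ j) (x y w : Fˣ)
    (hw : (x : F) ^ 2 * d i + (y : F) ^ 2 * d j = w) :
    ∃ d' : ι → Fˣ, OrthFamily B (Function.update
      (Function.update b i ((x : F) • b i + (y : F) • b j)) j
        (((y : F) * d j) • b i - ((x : F) * d i) • b j)) d' ∧ sigmaPoly d' = sigmaPoly d := by
  have hij0 := h.1 i j hij
  have hji0 := h.1 j i hij.symm
  refine ⟨Function.update (Function.update d i w) j (d i * d j * w), ⟨?_, ?_⟩, ?_⟩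
  · have hs : ∀ p q : V, B p q = B q p := fun p q => hB.eq p q
    intro p q hpq
    by_cases hpj : p = j
    · subst hpj
      by_cases hqi : q = i
      · subst hqi
        simp [Function.update_of_ne hij, h.2, hij0, hji0]; ring
      · simp [hqi, hpq.symm, h.1 i q (Ne.symm hqi), h.1 p q hpq]
    · by_cases hpi : p = i
      · subst hpi
        by_cases hqj : q = j
        · subst hqj
          simp [hpj, h.2, hij0, hji0]; ring
        · simp [hpj, hqj, hpq.symm, h.1 p q hpq, h.1 j q (Ne.symm hqj)]
      · by_cases hqj : q = j
        · subst hqj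
          simp [hpj, hpi, h.1 p i hpi, h.1 p q hpj]
        · by_cases hqi : q = i
          · subst hqi
            simp [hpj, hpi, hqj, h.1 p q hpi, h.1 p j hpj]
          · simp [hpj, hpi, hqj, hqi, h.1 p q hpq]
  · intro p
    by_cases hpj : p = j
    · subst hpj
      simp [h.2, hij0, hji0, ← hw]; ring
    · by_cases hpi : p = i
      · subst hpi
        simp [hpj, h.2, hij0, hji0, ← hw]; ring
      · simp [hpj, hpi, h.2]
  · have h1 := symb_binary (x ^ 2 * d i) (y ^ 2 * d j) w (by push_cast; exact hw)
    have h2 : symb (x ^ 2 * d i * (y ^ 2 * d j) * w) = symb (d i * d j * w) := by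
      simp only [symb_mul (_ * _) w, symb_mul (_ * _) (_ * _), symb_sq_mul, symb_mul (d i) (d j)]
    rw [h2, symb_sq_mul, symb_sq_mul] at h1
    refine sigmaPoly_update_two d hij _ _ ?_ h1.symm
    rw [symb_mul, symb_mul]
    linear_combination MilnorK2.add_self (symb w)

theorem OrthFamily.concentrate [NeZero (2 : F)] {B : LinearMap.BilinForm F V} (hB : B.IsSymm)
    (v : V) (u : Fˣ) (hv : B v v = u) (N : ℕ) :
    ∀ (b : ι → V) (d : ι → Fˣ) (s : Finset ι) (x : ι → Fˣ), OrthFamily B b d → s.card = N →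
      v = ∑ i ∈ s, (x i : F) • b i →
      ∃ (b' : ι → V) (d' : ι → Fˣ), OrthFamily B b' d' ∧ sigmaPoly d' = sigmaPoly d ∧
        (∀ i ∉ s, b' i = b i) ∧ ∃ i ∈ s, b' i = v := by
  classical
  induction N with
  | zero =>
    intro b d s x h hs hvs
    rw [Finset.card_eq_zero] at hs
    subst hs
    rw [Finset.sum_empty] at hvs
    subst hvs
    exact absurd hv.symm (by simp)
  | succ N ih =>
    intro b d s x h hs hvs
    by_cases hN : N = 0
    · subst hN
      obtain ⟨i, rfl⟩ := Finset.card_eq_one.mp hs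
      rw [Finset.sum_singleton] at hvs
      refine ⟨Function.update b i v, Function.update d i (x i ^ 2 * d i), ⟨?_, ?_⟩,
        sigmaPoly_update d i _ (symb_sq_mul _ _), ?_, i, by simp, by simp⟩
      · intro p q hpq
        by_cases hp : p = i
        · subst hp
          simp [hpq.symm, hvs, h.1 p q hpq]
        · by_cases hq : q = i
          · subst hq
            simp [hp, hvs, h.1 p q hpq]
          · simp [hp, hq, h.1 p q hpq]
      · intro p
        by_cases hp : p = i
        · subst hp
          simp [hvs, h.2]; ring
        · simp [hp, h.2]
      · intro p hp
        have : p ≠ i := by simpa using hp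
        simp [this]
    · obtain ⟨i, hi, j, hj, hij, hq⟩ : ∃ i ∈ s, ∃ j ∈ s, i ≠ j ∧
          (x i : F) ^ 2 * d i + (x j : F) ^ 2 * d j ≠ 0 := by
        by_contra! hcon
        obtain ⟨i, hi, j, hj, hij⟩ := Finset.one_lt_card.mp (by omega : 1 < s.card)
        by_cases hN1 : N = 1
        · have hsij : s = {i, j} := by
            refine (Finset.eq_of_subset_of_card_le ?_ ?_).symm
            · intro l hl
              rcases Finset.mem_insert.mp hl with rfl | hl
              · exact hi
              · rw [Finset.mem_singleton.mp hl]; exact hj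
            · rw [Finset.card_pair hij]; omega
          rw [hsij, Finset.sum_pair hij] at hvs
          apply u.ne_zero
          rw [← hv, hvs, ← hcon i hi j hj hij]
          simp [h.2, h.1 i j hij, h.1 j i hij.symm]; ring
        · obtain ⟨l, hl, hlij⟩ : ∃ l ∈ s, l ∉ ({i, j} : Finset ι) := by
            by_contra! hsub
            have := Finset.card_le_card (show s ⊆ {i, j} from hsub)
            rw [Finset.card_pair hij] at this
            omega
          simp only [Finset.mem_insert, Finset.mem_singleton, not_or] at hlij
          have e1 := hcon i hi j hj hij
          have e2 := hcon i hi l hl (Ne.symm hlij.1)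
          have e3 := hcon j hj l hl (Ne.symm hlij.2)
          have e4 : 2 * ((x i : F) ^ 2 * d i) = 0 := by linear_combination e1 + e2 - e3
          rcases mul_eq_zero.mp e4 with e5 | e5
          · exact two_ne_zero e5
          · exact mul_ne_zero (pow_ne_zero 2 (x i).ne_zero) (d i).ne_zero e5
      obtain ⟨d1, h1, hd1⟩ := h.update_two hB hij (x i) (x j) (Units.mk0 _ hq) rfl
      obtain ⟨b', d', h', hd', hb', l, hl, hlv⟩ := ih _ d1 (s.erase j) (Function.update x i 1) h1
        (by rw [Finset.card_erase_of_mem hj, hs]; rfl) (by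
          have hi' : i ∈ s.erase j := Finset.mem_erase.mpr ⟨hij, hi⟩
          rw [hvs, ← Finset.add_sum_erase s _ hj, ← Finset.add_sum_erase (s.erase j) _ hi',
            ← Finset.add_sum_erase (s.erase j) _ hi', ← add_assoc]
          congr 1
          · simp [Function.update_of_ne hij, add_comm]
          · refine Finset.sum_congr rfl fun l hl => ?_
            simp only [Finset.mem_erase] at hl
            simp [hl.1, hl.2.1])
      refine ⟨b', d', h', hd'.trans hd1, ?_, l, Finset.mem_of_mem_erase hl, hlv⟩
      intro p hp
      have hpi : p ≠ i := fun e => hp (e ▸ hi)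
      have hpj : p ≠ j := fun e => hp (e ▸ hj)
      rw [hb' p (fun e => hp (Finset.mem_of_mem_erase e))]
      simp [hpi, hpj]

theorem OrthFamily.reindex {B : LinearMap.BilinForm F V}
    {b : ι → V} {d : ι → Fˣ} (h : OrthFamily B b d) (e : Equiv.Perm ι) :
    OrthFamily B (b ∘ e) (d ∘ e) ∧ sigmaPoly (d ∘ e) = sigmaPoly d :=
  ⟨⟨fun i j hij => h.1 _ _ (e.injective.ne hij), fun i => h.2 _⟩,
    Equiv.prod_comp e fun i => 1 + Polynomial.C (symb (d i)) * Polynomial.X⟩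

theorem OrthFamily.linearIndependent {B : LinearMap.BilinForm F V}
    {b : ι → V} {d : ι → Fˣ} (h : OrthFamily B b d) : LinearIndependent F b := by
  classical
  rw [Fintype.linearIndependent_iff]
  intro g hg i
  have h1 : B (∑ j, g j • b j) (b i) = g i * d i := by
    rw [map_sum, LinearMap.sum_apply, Finset.sum_eq_single i]
    · simp [h.2]
    · intro j _ hj
      simp [h.1 j i hj]
    · simp
  rw [hg, map_zero, LinearMap.zero_apply] at h1
  exact (mul_eq_zero.mp h1.symm).resolve_right (d i).ne_zero

theorem OrthFamily.sigmaPoly_eq [NeZero (2 : F)] [FiniteDimensional F V]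
    {B : LinearMap.BilinForm F V} (hB : B.IsSymm) {b c : ι → V} {d e : ι → Fˣ}
    (hcard : Fintype.card ι = Module.finrank F V)
    (hb : OrthFamily B b d) (hc : OrthFamily B c e) : sigmaPoly d = sigmaPoly e := by
  classical
  have key : ∀ S : Finset ι, ∃ (b' : ι → V) (d' : ι → Fˣ), OrthFamily B b' d' ∧
      sigmaPoly d' = sigmaPoly d ∧ ∀ i ∈ S, b' i = c i := by
    intro S
    induction S using Finset.induction_on with
    | empty => exact ⟨b, d, hb, rfl, by simp⟩
    | insert j S hjS ih =>
      obtain ⟨b1, d1, h1, hd1, hS⟩ := ih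
      have hspan := h1.linearIndependent.span_eq_top_of_card_eq_finrank' hcard
      have hmem : c j ∈ Submodule.span F (Set.range b1) := hspan ▸ Submodule.mem_top
      obtain ⟨g, hg⟩ := (Submodule.mem_span_range_iff_exists_fun F).mp hmem
      have hgB : ∀ i, B (c j) (b1 i) = g i * d1 i := by
        intro i
        rw [← hg, map_sum, LinearMap.sum_apply, Finset.sum_eq_single i]
        · simp [h1.2]
        · intro l _ hl
          simp [h1.1 l i hl]
        · simp
      have hgS : ∀ i ∈ S, g i = 0 := by
        intro i hi
        have h3 := hgB i
        rw [hS i hi, hc.1 j i (fun e => hjS (e ▸ hi))] at h3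
        exact (mul_eq_zero.mp h3.symm).resolve_right (d1 i).ne_zero
      obtain ⟨b2, d2, h2, hd2, hb2, l, hl, hlv⟩ := OrthFamily.concentrate hB (c j) (e j) (hc.2 j) _
        b1 d1 (Finset.univ.filter fun i => g i ≠ 0)
        (fun i => if hi : g i = 0 then 1 else Units.mk0 (g i) hi) h1 rfl (by
          rw [← hg, Finset.sum_filter]
          refine Finset.sum_congr rfl fun i _ => ?_
          by_cases hi : g i = 0 <;> simp [hi])
      have hlS : l ∉ S := fun hlS => (Finset.mem_filter.mp hl).2 (hgS l hlS)
      obtain ⟨h3, hd3⟩ := h2.reindex (Equiv.swap j l)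
      refine ⟨_, _, h3, hd3.trans (hd2.trans hd1), ?_⟩
      intro i hi
      rcases Finset.mem_insert.mp hi with rfl | hi
      · simpa using hlv
      · have hij : i ≠ j := fun e => hjS (e ▸ hi)
        have hil : i ≠ l := fun e => hlS (e ▸ hi)
        rw [Function.comp_apply, Equiv.swap_apply_of_ne_of_ne hij hil, hb2 i (by simp [hgS i hi]),
          hS i hi]
  obtain ⟨b', d', h', hd', hall⟩ := key Finset.univ
  rw [← hd']
  congr 1
  ext i
  rw [← h'.2 i, hall i (Finset.mem_univ i), hc.2 i]

theorem exists_orthFamily [Invertible (2 : F)] {Q : QuadraticForm F V} {d : ι → Fˣ}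
    (h : QuadraticMap.Equivalent Q (QuadraticMap.weightedSumSquares F d)) :
    ∃ b : ι → V, OrthFamily (QuadraticMap.associated Q) b d := by
  classical
  obtain ⟨f⟩ := h
  refine ⟨fun i => f.symm (Pi.single i 1), ?_, ?_⟩
  · intro i j hij
    rw [QuadraticMap.associated_apply, ← map_add]
    simp only [QuadraticMap.IsometryEquiv.map_app, QuadraticMap.weightedSumSquares_apply]
    have h1 : ∀ l : ι, (Pi.single i 1 + Pi.single j 1 : ι → F) l *
        (Pi.single i 1 + Pi.single j 1 : ι → F) l = (Pi.single i 1 : ι → F) l *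
        (Pi.single i 1 : ι → F) l + (Pi.single j 1 : ι → F) l * (Pi.single j 1 : ι → F) l := by
      intro l
      by_cases hi : l = i
      · subst hi; simp [hij]
      · simp [hi]
    simp only [h1, smul_add, Finset.sum_add_distrib]
    simp
  · intro i
    rw [QuadraticMap.associated_eq_self_apply]
    simp only [QuadraticMap.IsometryEquiv.map_app, QuadraticMap.weightedSumSquares_apply]
    rw [Finset.sum_eq_single i] <;> simp +contextual [Units.smul_def]

/-- The classes `σ_i` of the coefficients of a diagonalization depend only on the form. -/
theorem sigma_eq_of_equivalent [NeZero (2 : F)] [FiniteDimensional F V] {Q : QuadraticForm F V}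
    {d e : Fin (Module.finrank F V) → Fˣ}
    (hd : QuadraticMap.Equivalent Q (QuadraticMap.weightedSumSquares F d))
    (he : QuadraticMap.Equivalent Q (QuadraticMap.weightedSumSquares F e)) (n : ℕ) :
    sigma n d = sigma n e := by
  have : Invertible (2 : F) := invertibleOfNonzero two_ne_zero
  obtain ⟨b, hb⟩ := exists_orthFamily hd
  obtain ⟨c, hc⟩ := exists_orthFamily he
  rw [← coeff_sigmaPoly, ← coeff_sigmaPoly,
    OrthFamily.sigmaPoly_eq ⟨QuadraticMap.associated_isSymm F Q⟩ (by simp) hb hc]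

end WellDefined

/-! Stiefel-Whitney classes of quadratic forms and of étale algebras. -/

open Classical in
/-- The `i`-th Stiefel-Whitney class of a nondegenerate quadratic form in characteristic different
from two: `σ_i` of the coefficients of a diagonalization. All diagonalizations give the same value
(`sigma_eq_of_equivalent`); every such form has one, so the last case is for degenerate input. -/
def quadraticSW {F : Type u} [Field F] {V : Type v} [AddCommGroup V] [Module F V]
    (i : ℕ) (Q : QuadraticForm F V) : MilnorK2 F :=
  if h : ∃ d : Fin (Module.finrank F V) → Fˣ,
      QuadraticMap.Equivalent Q (QuadraticMap.weightedSumSquares F d)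
  then sigma i h.choose
  else 0

/-- The trace form `x ↦ tr(x²)` of an algebra. -/
def traceQuadraticForm (F : Type u) (E : Type v) [Field F] [CommRing E] [Algebra F E] :
    QuadraticForm F E :=
  LinearMap.BilinMap.toQuadraticMap (Algebra.traceForm F E)

/-- The `i`-th Stiefel-Whitney class of an étale algebra: that of its trace form. -/
def etaleSW (F : Type u) (E : Type v) [Field F] [CommRing E] [Algebra F E] (i : ℕ) : MilnorK2 F :=
  quadraticSW i (traceQuadraticForm F E)

/-- The `i`-th Galois-Stiefel-Whitney class of an étale `F`-algebra `E`, where `F` has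
characteristic different from two, in terms of its Stiefel-Whitney classes `w_i`:
`w_i` for odd `i`, and `w_i + {2} w_{i-1}` for even `i` (with `w_{-1} = 0`). The characteristic
properties of these classes, `α_tot(F) = 1`, `α_tot(F(√a)) = 1 + {a}` and
`α_tot(E × E') = α_tot(E) α_tot(E')`, are `galoisSW_self`, `galoisSW_quadratic` and
`galoisSW_prod` below. -/
def galoisSW (F : Type u) (E : Type v) [Field F] [NeZero (2 : F)] [CommRing E] [Algebra F E] :
    ℕ → MilnorK2 F
  | 0 => etaleSW F E 0
  | i + 1 =>
    if Even (i + 1) then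
      etaleSW F E (i + 1) + symb (Units.mk0 (2 : F) two_ne_zero) * etaleSW F E i
    else etaleSW F E (i + 1)

section Properties

variable {F : Type u} [Field F]

theorem quadraticSW_eq [NeZero (2 : F)] {V : Type v} [AddCommGroup V] [Module F V]
    {ι : Type*} [Fintype ι] {Q : QuadraticForm F V} {d : ι → Fˣ}
    (h : QuadraticMap.Equivalent Q (QuadraticMap.weightedSumSquares F d)) (n : ℕ) :
    quadraticSW n Q = (sigmaPoly d).coeff n := by
  have ⟨f⟩ := h
  have : FiniteDimensional F V := f.toLinearEquiv.symm.finiteDimensional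
  have hcard : Fintype.card ι = Module.finrank F V := by
    rw [f.toLinearEquiv.finrank_eq, Module.finrank_fintype_fun_eq_card]
  let e : Fin (Module.finrank F V) ≃ ι := (finCongr hcard.symm).trans (Fintype.equivFin ι).symm
  have h' : QuadraticMap.Equivalent Q (QuadraticMap.weightedSumSquares F (d ∘ e)) := by
    refine h.trans ⟨⟨LinearEquiv.funCongrLeft F F e, fun x => ?_⟩⟩
    simp only [QuadraticMap.weightedSumSquares_apply]
    exact Equiv.sum_comp e fun i => d i • (x i * x i)
  have hex : ∃ d : Fin (Module.finrank F V) → Fˣ,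
      QuadraticMap.Equivalent Q (QuadraticMap.weightedSumSquares F d) := ⟨_, h'⟩
  rw [quadraticSW, dif_pos hex, sigma_eq_of_equivalent hex.choose_spec h' n, ← coeff_sigmaPoly]
  congr 1
  exact Equiv.prod_comp e fun i => 1 + Polynomial.C (symb (d i)) * Polynomial.X

/-- `{2}{2} = 0`. -/
theorem symb_two_sq [NeZero (2 : F)] :
    symb (Units.mk0 (2 : F) two_ne_zero) * symb (Units.mk0 (2 : F) two_ne_zero) = 0 := by
  have h1 := symb_mul_neg (Units.mk0 (2 : F) two_ne_zero)
  have h2 := symb_steinberg (Units.mk0 (2 : F) two_ne_zero) (-1) (by norm_num)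
  rw [← mul_neg_one, symb_mul, mul_add, h2, add_zero] at h1
  exact h1

variable [NeZero (2 : F)] {E : Type v} [CommRing E] [Algebra F E]

/-- The generating polynomial of the Galois-Stiefel-Whitney classes of an algebra whose trace form
has the diagonal coefficients `d`. -/
theorem galoisSW_eq {ι : Type*} [Fintype ι] {d : ι → Fˣ}
    (h : QuadraticMap.Equivalent (traceQuadraticForm F E) (QuadraticMap.weightedSumSquares F d))
    (n : ℕ) :
    galoisSW F E n = (sigmaPoly d + Polynomial.C (symb (Units.mk0 (2 : F) two_ne_zero)) *
      (Polynomial.derivative (sigmaPoly d) * Polynomial.X ^ 2)).coeff n := by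
  have hw := quadraticSW_eq h
  have hpar : ∀ m : ℕ, (m : MilnorK2 F) = if Even m then 0 else 1 := by
    intro m
    split_ifs with hm
    · obtain ⟨r, rfl⟩ := hm
      rw [Nat.cast_add, MilnorK2.add_self]
    · obtain ⟨r, rfl⟩ := Nat.not_even_iff_odd.mp hm
      rw [Nat.cast_add, Nat.cast_mul, Nat.cast_ofNat, MilnorK2.two_eq_zero, zero_mul, zero_add,
        Nat.cast_one]
  rw [Polynomial.coeff_add, Polynomial.coeff_C_mul]
  match n with
  | 0 => simp [galoisSW, etaleSW, hw]
  | 1 =>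
    rw [Polynomial.coeff_mul_X_pow']
    simp [galoisSW, etaleSW, hw]
  | n + 2 =>
    rw [Polynomial.coeff_mul_X_pow, Polynomial.coeff_derivative]
    have hc := hpar (n + 1)
    rw [Nat.cast_add, Nat.cast_one] at hc
    rw [hc]
    by_cases hn : Even n <;> simp [galoisSW, etaleSW, hw, Nat.even_add_one, hn]

/-- The total class of the trivial extension is `1`. -/
theorem galoisSW_self (n : ℕ) : galoisSW F F n = if n = 0 then 1 else 0 := by
  have h : QuadraticMap.Equivalent (traceQuadraticForm F F)
      (QuadraticMap.weightedSumSquares F (fun _ : Unit => (1 : Fˣ))) := by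
    refine ⟨⟨(LinearEquiv.funUnique Unit F F).symm, fun x => ?_⟩⟩
    simp [traceQuadraticForm, Algebra.traceForm_apply]
  rw [galoisSW_eq h]
  simp [sigmaPoly, symb_one, Polynomial.coeff_one]

/-- The total class of `F(√a)` is `1 + {a}`. -/
theorem galoisSW_quadratic (b : Module.Basis (Fin 2) F E) (a : Fˣ) (h0 : b 0 = 1)
    (h1 : b 1 * b 1 = algebraMap F E a) (n : ℕ) :
    galoisSW F E n = if n = 0 then 1 else if n = 1 then symb a else 0 := by
  have h10 : Algebra.trace F E 1 = 2 := by
    rw [← map_one (algebraMap F E), Algebra.trace_algebraMap_of_basis b]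
    simp
  have h11 : Algebra.trace F E (b 1) = 0 := by
    rw [Algebra.trace_eq_matrix_trace b, Matrix.trace_fin_two, Algebra.leftMulMatrix_eq_repr_mul,
      Algebra.leftMulMatrix_eq_repr_mul, h1, h0, mul_one, Algebra.algebraMap_eq_smul_one, ← h0]
    simp
  have h : QuadraticMap.Equivalent (traceQuadraticForm F E)
      (QuadraticMap.weightedSumSquares F
        ![Units.mk0 (2 : F) two_ne_zero, Units.mk0 (2 : F) two_ne_zero * a]) := by
    refine ⟨⟨b.equivFun, fun x => ?_⟩⟩
    obtain ⟨y, rfl⟩ := b.equivFun.symm.surjective x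
    have hx := b.equivFun_symm_apply y
    rw [Fin.sum_univ_two, h0] at hx
    change QuadraticMap.weightedSumSquares F _ (b.equivFun (b.equivFun.symm y)) = _
    rw [LinearEquiv.apply_symm_apply, hx, traceQuadraticForm, LinearMap.BilinMap.toQuadraticMap_apply, Algebra.traceForm_apply]
    have : (y 0 • (1 : E) + y 1 • b 1) * (y 0 • (1 : E) + y 1 • b 1) =
        (y 0 * y 0 + y 1 * y 1 * a) • (1 : E) + (2 * y 0 * y 1) • b 1 := by
      simp only [Algebra.smul_def, map_add, map_mul, ← h1, map_ofNat]
      ring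
    rw [this, map_add, map_smul, map_smul, h10, h11]
    simp [Fin.sum_univ_two, Units.smul_def]
    ring
  rw [galoisSW_eq h, sigmaPoly, Fin.prod_univ_two]
  simp only [Matrix.cons_val_zero, Matrix.cons_val_one, symb_mul]
  have ht := congrArg (Polynomial.C (R := MilnorK2 F)) (symb_two_sq (F := F))
  have h2 := congrArg (Polynomial.C (R := MilnorK2 F)) (MilnorK2.two_eq_zero (F := F))
  generalize symb (Units.mk0 (2 : F) two_ne_zero) = t at *
  have key : (1 + Polynomial.C t * Polynomial.X) * (1 + Polynomial.C (t + symb a) * Polynomial.X) +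
      Polynomial.C t * (Polynomial.derivative ((1 + Polynomial.C t * Polynomial.X) *
        (1 + Polynomial.C (t + symb a) * Polynomial.X)) * Polynomial.X ^ 2) =
      1 + Polynomial.C (symb a) * Polynomial.X := by
    simp only [map_mul, map_zero, map_ofNat] at ht h2
    simp only [Polynomial.derivative_mul, Polynomial.derivative_one,
      Polynomial.derivative_C, Polynomial.derivative_X, map_add]
    linear_combination (Polynomial.C t * Polynomial.X +
      Polynomial.C t * Polynomial.C (symb a) * Polynomial.X ^ 2) * h2 +
      (3 * Polynomial.X ^ 2 + 2 * (Polynomial.C t + Polynomial.C (symb a)) * Polynomial.X ^ 3) * ht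
  rw [key]
  match n with
  | 0 => simp
  | 1 => simp [Polynomial.coeff_one]
  | n + 2 => simp [Polynomial.coeff_one]

/-- The total class is multiplicative. -/
theorem galoisSW_prod {E' : Type*} [CommRing E'] [Algebra F E']
    {ι ι' : Type*} [Fintype ι] [Fintype ι'] {d : ι → Fˣ} {d' : ι' → Fˣ}
    (h : QuadraticMap.Equivalent (traceQuadraticForm F E) (QuadraticMap.weightedSumSquares F d))
    (h' : QuadraticMap.Equivalent (traceQuadraticForm F E')
      (QuadraticMap.weightedSumSquares F d')) (n : ℕ) :
    galoisSW F (E × E') n =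
      ∑ p ∈ Finset.HasAntidiagonal.antidiagonal n, galoisSW F E p.1 * galoisSW F E' p.2 := by
  have hp : QuadraticMap.Equivalent (traceQuadraticForm F (E × E'))
      (QuadraticMap.weightedSumSquares F (Sum.elim d d')) := by
    obtain ⟨f⟩ := h
    obtain ⟨f'⟩ := h'
    refine ⟨⟨(f.toLinearEquiv.prodCongr f'.toLinearEquiv).trans
      (LinearEquiv.sumArrowLequivProdArrow ι ι' F F).symm, fun x => ?_⟩⟩
    have e1 := f.map_app x.1
    have e2 := f'.map_app x.2
    rw [QuadraticMap.weightedSumSquares_apply] at e1 e2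
    change QuadraticMap.weightedSumSquares F (Sum.elim d d') (Sum.elim (f x.1) (f' x.2)) = _
    rw [QuadraticMap.weightedSumSquares_apply, Fintype.sum_sum_type]
    simp only [Sum.elim_inl, Sum.elim_inr, e1, e2]
    have : FiniteDimensional F E := f.toLinearEquiv.symm.finiteDimensional
    have : FiniteDimensional F E' := f'.toLinearEquiv.symm.finiteDimensional
    simp [traceQuadraticForm, Algebra.traceForm_apply, Algebra.trace_prod_apply]
  have hP : sigmaPoly (Sum.elim d d') = sigmaPoly d * sigmaPoly d' := by
    simp [sigmaPoly, Fintype.prod_sum_type]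
  simp only [galoisSW_eq h, galoisSW_eq h', galoisSW_eq hp, hP]
  rw [← Polynomial.coeff_mul]
  congr 1
  have ht := congrArg (Polynomial.C (R := MilnorK2 F)) (symb_two_sq (F := F))
  rw [map_mul, map_zero] at ht
  rw [Polynomial.derivative_mul]
  linear_combination -(Polynomial.derivative (sigmaPoly d) * Polynomial.X ^ 2 *
    Polynomial.derivative (sigmaPoly d') * Polynomial.X ^ 2) * ht

end Properties

/-! The generic multiquadratic extension. -/

/-- The rational function field `k(a₁, …, a_n)`. -/
abbrev GenericField (k : Type u) [Field k] (n : ℕ) : Type u :=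
  FractionRing (MvPolynomial (Fin n) k)

/-- The variable `a_j` as a unit of `k(a₁, …, a_n)`. -/
def coord (k : Type u) [Field k] (n : ℕ) (j : Fin n) : (GenericField k n)ˣ :=
  Units.mk0 (algebraMap (MvPolynomial (Fin n) k) (GenericField k n) (MvPolynomial.X j))
    (by
      rw [Ne, FaithfulSMul.algebraMap_eq_zero_iff]
      exact MvPolynomial.X_ne_zero j)

instance (k : Type u) [Field k] [NeZero (2 : k)] (n : ℕ) : NeZero (2 : GenericField k n) :=
  ⟨by
    have h := (algebraMap k (GenericField k n)).injective.ne (two_ne_zero (α := k))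
    rwa [map_zero, map_ofNat] at h⟩

/-- The extension `k(√a₁, …, √a_n)` of `k(a₁, …, a_n)`: the subfield of an algebraic closure
generated over `k(a₁, …, a_n)` by all square roots of the variables. -/
abbrev MultiquadraticField (k : Type u) [Field k] (n : ℕ) : Type u :=
  IntermediateField.adjoin (GenericField k n)
    {x : AlgebraicClosure (GenericField k n) |
      ∃ j : Fin n, x ^ 2 = algebraMap (GenericField k n) (AlgebraicClosure (GenericField k n))
        (coord k n j : GenericField k n)}

/-- The family of all products `∏_{j ∈ I} a_j`, for `I` a nonempty subset of the index set:
`a₁, …, a_n, a₁a₂, …, a₁⋯a_n`. -/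
def coordProducts (k : Type u) [Field k] (n : ℕ) :
    {I : Finset (Fin n) // I.Nonempty} → (GenericField k n)ˣ :=
  fun I => ∏ j ∈ I.1, coord k n j

end MultiquadraticSW

end

namespace MultiquadraticSW

universe u

/-! The classes `sigma i` are the coefficients of ∏_I (1 + {a_I} X), where {a_I} is the sum of {a_j}
over j in I. So the theorem is about a product over all subset sums of the x_j = {a_j}. Only two
facts about the symbols enter: 2 = 0, and x_j² = ε x_j, which follows from {a}{-a} = 0. Under them
the product collapses to 1 + q X^(2^(n-1)) (`prod_powerset_add_sum_mul`), with q = ε^(2^(n-1)-n) ∏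
(ε + x_j) + ε^(2^(n-1)). Expanding ∏ (ε + x_j) over subsets cancels the empty term and gives the
stated formula (`pow_mul_prod_add_eq_sum`).

For the étale algebra, the products of the √a_j form a basis of E_n. They are independent because
the √a_j are themselves algebraically independent over k, so exponents can be compared modulo 2. The
trace form is diagonal in this basis, with entries 2^n a_I. Its generating polynomial is therefore
the one above twisted by z = 2^n, with u = 1 + n{2} X in place of 1. The passage from
Stiefel-Whitney to Galois-Stiefel-Whitney classes is P ↦ P + {2} X² P', and since {2}{2} = 0 it
undoes exactly this twist (`add_C_mul_derivative_eq`). Both families of classes are thus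
coefficients of one polynomial. -/

/-! ### Products over subset sums in characteristic two -/

/-- In characteristic two, for elements with `x j ^ 2 = e * x j`, the product over all subset
sums of `x` collapses to two terms. -/
theorem prod_powerset_add_sum_mul {R ι : Type*} [CommRing R] [DecidableEq ι]
    (h2 : (2 : R) = 0) {e : R} {x : ι → R} (hx : ∀ j, x j ^ 2 = e * x j) (s : Finset ι) (hs : s.Nonempty) :
    ∃ q : R, q = e ^ (2 ^ (s.card - 1) - s.card) * ∏ j ∈ s, (e + x j) + e ^ 2 ^ (s.card - 1) ∧
      q ^ 2 = e ^ 2 ^ (s.card - 1) * q ∧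
      ∀ u t : R, ∏ I ∈ s.powerset, (u + (∑ j ∈ I, x j) * t) =
        u ^ 2 ^ s.card + u ^ 2 ^ (s.card - 1) * q * t ^ 2 ^ (s.card - 1) := by
  induction hs using Finset.Nonempty.cons_induction with
  | singleton a =>
    refine ⟨x a, ?_, by simpa using hx a, fun u t => ?_⟩
    · simp only [Finset.card_singleton, Finset.prod_singleton]
      norm_num
      linear_combination -e * h2
    · rw [← insert_empty_eq, Finset.prod_powerset_insert (by simp)]
      simp
      ring
  | cons a s ha hs ih =>
    obtain ⟨q, hq, hqq, h⟩ := ih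
    -- This bound makes the subtraction in the exponent of `e` a genuine one.
    have hle : s.card ≤ 2 ^ (s.card - 1) := by
      have := Nat.lt_two_pow_self (n := s.card - 1)
      omega
    obtain ⟨c, hc⟩ : ∃ c, s.card = c + 1 := ⟨s.card - 1, by have := hs.card_pos; omega⟩
    rw [Finset.card_cons, Finset.cons_eq_insert]
    simp only [Finset.prod_powerset_insert ha, Finset.prod_insert ha]
    rw [hc] at hle hq h hqq ⊢
    simp only [Nat.add_sub_cancel] at hle hq h hqq ⊢
    obtain ⟨m, hm⟩ : ∃ m, 2 ^ c = m + 1 := ⟨2 ^ c - 1, (Nat.sub_add_cancel Nat.one_le_two_pow).symm⟩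
    have hpow : ∀ k : ℕ, x a ^ (k + 1) = e ^ k * x a := by
      intro k
      induction k with
      | zero => simp
      | succ k ih => rw [pow_succ, ih, mul_assoc, ← pow_two, hx, pow_succ, mul_assoc]
    have hxm : x a ^ 2 ^ c = e ^ m * x a := by rw [hm, hpow]
    have hadd : ∀ u v : R, (u + v) ^ 2 ^ c = u ^ 2 ^ c + v ^ 2 ^ c := by
      intro u v
      -- `2 = 0` gives characteristic two, hence additivity of Frobenius, only when `1 ≠ 0`; the
      -- zero ring is treated apart.
      rcases subsingleton_or_nontrivial R with _ | _
      · exact Subsingleton.elim _ _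
      · have := CharTwo.of_one_ne_zero_of_two_eq_zero one_ne_zero h2
        exact add_pow_char_pow u v 2 c
    obtain ⟨d, hd⟩ : ∃ d, 2 ^ c - (c + 1) = d := ⟨_, rfl⟩
    have hd' : 2 ^ (c + 1) - (c + 1 + 1) = m + d := by rw [pow_succ]; omega
    rw [hd']
    rw [hd] at hq
    -- The new `q` is the coefficient of U²T² in (U² + UqT)(V² + VqT), where V = U + e^m x_a T.
    -- Modulo 2, adding e^(2m+2) to it gives e^m (e + x_a)(q + e^(m+1)), so each step contributes
    -- one factor e + x_a.
    refine ⟨e ^ (m + 1) * q + e ^ (2 * m + 1) * x a + e ^ m * x a * q, ?_, ?_, ?_⟩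
    · rw [pow_succ 2 c, pow_mul, hm]
      rw [hm] at hq
      linear_combination (e ^ (m + 1) + e ^ m * x a) * hq + e ^ (2 * m + 1) * x a * h2
    · rw [pow_succ 2 c, pow_mul, hm]
      rw [hm] at hqq
      linear_combination (e ^ (2 * m + 2) + e ^ (2 * m + 1) * x a) * hqq +
        (e ^ (4 * m + 2) + e ^ (2 * m) * q ^ 2) * hx a +
        (e ^ (3 * m + 2) * x a * q + e ^ (2 * m + 1) * x a * q ^ 2 +
          e ^ (3 * m + 1) * x a ^ 2 * q) * h2
    · intro u t
      -- The subsets containing `a` give the same product with `u` shifted to u + x_a t, so the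
      -- induction hypothesis is used twice.
      have h' : ∏ I ∈ s.powerset, (u + (∑ j ∈ insert a I, x j) * t) =
          ∏ I ∈ s.powerset, ((u + x a * t) + (∑ j ∈ I, x j) * t) := by
        refine Finset.prod_congr rfl fun I hI => ?_
        rw [Finset.sum_insert fun hI' => ha (Finset.mem_powerset.mp hI hI')]
        ring
      rw [h', h, h, pow_succ 2 (c + 1), pow_succ 2 c]
      simp only [pow_mul, hadd, mul_pow, hxm]
      rw [hm] at hqq
      generalize u ^ 2 ^ c = U
      generalize t ^ 2 ^ c = T
      -- The relation q² = e^(2^c) q turns the UT³ term into twice a single term, so that it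
      -- vanishes; this is why it is carried through the induction.
      linear_combination (U ^ 2 * T ^ 2 + U * T ^ 3 * e ^ m * x a) * hqq +
        (U ^ 2 * T ^ 2 + U * T ^ 3 * q) * e ^ (2 * m) * hx a +
        (U ^ 3 * e ^ m * x a * T + U ^ 3 * q * T + U ^ 2 * e ^ m * x a * q * T ^ 2 +
          U * T ^ 3 * q * e ^ (2 * m + 1) * x a) * h2


/-! ### Linear independence of products of square roots -/

/-- Since k[a] ⊆ k[r], the algebra `A` is algebraic over k[r]. A finite family with this property,
having as many members as the transcendence degree, must be a transcendence basis. -/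
theorem algebraicIndependent_of_sq {k A ι : Type*} [Field k] [Field A] [Algebra k A] [Finite ι]
    {a r : ι → A} (ha : IsTranscendenceBasis k a) (hr : ∀ j, r j ^ 2 = a j) :
    AlgebraicIndependent k r := by
  have hle : Algebra.adjoin k (Set.range a) ≤ Algebra.adjoin k (Set.range r) := by
    rw [Algebra.adjoin_le_iff]
    rintro _ ⟨j, rfl⟩
    rw [SetLike.mem_coe, ← hr]
    exact pow_mem (Algebra.subset_adjoin (Set.mem_range_self j)) 2
  have halg := ha.isAlgebraic
  have : Algebra.IsAlgebraic (Algebra.adjoin k (Set.range r)) A := by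
    constructor
    intro x
    obtain ⟨p, hp, hpx⟩ := halg.isAlgebraic x
    refine ⟨p.map (Subalgebra.inclusion hle).toRingHom, ?_, ?_⟩
    · rwa [Ne, Polynomial.map_eq_zero_iff]
      exact Subalgebra.inclusion_injective hle
    · rw [Polynomial.aeval_def, Polynomial.eval₂_map]
      exact hpx
  exact (Algebra.IsAlgebraic.isTranscendenceBasis_of_lift_le_trdeg_of_finite k r
    ha.lift_cardinalMk_eq_trdeg.le).1

theorem isTranscendenceBasis_coord (k : Type u) [Field k] (n : ℕ) :
    IsTranscendenceBasis k fun j => algebraMap (GenericField k n)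
      (AlgebraicClosure (GenericField k n)) (coord k n j) :=
  have : Algebra.IsAlgebraic (MvPolynomial (Fin n) k) (GenericField k n) :=
    IsLocalization.isAlgebraic _ (nonZeroDivisors _)
  ((IsTranscendenceBasis.mvPolynomial (Fin n) k).algebraMap_comp
    (A := GenericField k n)).algebraMap_comp

/-- Every exponent in the I-th summand is congruent modulo 2 to the indicator of I, so distinct
summands share no monomial. The coefficient of `c J` at m is read off at the exponent 2m + 1_J. -/
theorem eq_zero_of_sum_expand_mul_monomial {k ι : Type*} [CommRing k] [Fintype ι] [DecidableEq ι]
    (c : Finset ι → MvPolynomial ι k)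
    (h : ∑ I, MvPolynomial.expand 2 (c I) * ∏ j ∈ I, MvPolynomial.X j = 0) (J : Finset ι) :
    c J = 0 := by
  have hmon : ∀ I : Finset ι, (∏ j ∈ I, MvPolynomial.X j : MvPolynomial ι k) =
      MvPolynomial.monomial (∑ j ∈ I, Finsupp.single j 1) 1 := by
    intro I
    rw [MvPolynomial.monomial_sum_one]
    rfl
  have hind : ∀ (I : Finset ι) (j : ι),
      (∑ j ∈ I, Finsupp.single j 1 : ι →₀ ℕ) j = if j ∈ I then 1 else 0 := by
    intro I j
    simp [Finsupp.finsetSum_apply, Finsupp.single_apply]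
  ext m
  have h1 := congrArg (MvPolynomial.coeff (2 • m + ∑ j ∈ J, Finsupp.single j 1)) h
  rw [MvPolynomial.coeff_sum, Finset.sum_eq_single J, hmon, MvPolynomial.coeff_mul_monomial,
    MvPolynomial.coeff_expand_smul _ two_ne_zero, mul_one] at h1
  · exact h1
  · intro I _ hIJ
    rw [hmon, MvPolynomial.coeff_mul_monomial']
    split_ifs with hle
    · obtain ⟨j, hj⟩ : ∃ j, ¬ (j ∈ I ↔ j ∈ J) := by
        by_contra! hcon
        exact hIJ (Finset.ext hcon)
      rw [MvPolynomial.coeff_expand_of_not_dvd (i := j), zero_mul]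
      -- The exponent left at `j` is odd. When `j` lies in I but not in J, `hle` excludes a
      -- subtraction truncated to zero.
      have := hle j
      simp only [Finsupp.add_apply, Finsupp.tsub_apply, Finsupp.smul_apply, hind] at this ⊢
      by_cases hI : j ∈ I <;> by_cases hJ : j ∈ J <;> simp_all; omega
    · rfl
  · simp

/-- Subset products of square roots of the variables are linearly independent. -/
theorem linearIndependent_prod_sqrt (k : Type u) [Field k] (n : ℕ)
    {r : Fin n → AlgebraicClosure (GenericField k n)}
    (hr : ∀ j, r j ^ 2 = algebraMap (GenericField k n) _ (coord k n j)) :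
    LinearIndependent (GenericField k n) fun I : Finset (Fin n) => ∏ j ∈ I, r j := by
  -- Clearing denominators reduces to polynomial coefficients. A polynomial p in the a_j = r_j² is
  -- p(X²) evaluated at r, so a relation becomes an identity between polynomials in the independent
  -- r_j.
  rw [← LinearIndependent.iff_fractionRing (MvPolynomial (Fin n) k), Fintype.linearIndependent_iff]
  intro c hc
  have hind := algebraicIndependent_of_sq (isTranscendenceBasis_coord k n) hr
  have haev : ∀ p : MvPolynomial (Fin n) k, algebraMap (MvPolynomial (Fin n) k)
      (AlgebraicClosure (GenericField k n)) p = MvPolynomial.aeval r (MvPolynomial.expand 2 p) := by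
    intro p
    rw [MvPolynomial.aeval_expand]
    have : r ^ 2 = fun j => algebraMap (MvPolynomial (Fin n) k)
        (AlgebraicClosure (GenericField k n)) (MvPolynomial.X j) := by
      ext j
      exact (hr j).trans (IsScalarTower.algebraMap_apply _ _ _ _).symm
    rw [this]
    change (IsScalarTower.toAlgHom k (MvPolynomial (Fin n) k) _) p = _
    rw [MvPolynomial.aeval_unique (IsScalarTower.toAlgHom k (MvPolynomial (Fin n) k) _)]
    rfl
  refine eq_zero_of_sum_expand_mul_monomial c (hind ?_)
  rw [map_zero, ← hc, map_sum]
  refine Finset.sum_congr rfl fun I _ => ?_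
  rw [map_mul, map_prod, Algebra.smul_def, haev]
  simp


/-! ### The trace form of a multiquadratic algebra -/

theorem prod_mul_prod_eq_symmDiff {R ι : Type*} [CommMonoid R] [DecidableEq ι] (r : ι → R)
    (I J : Finset ι) :
    (∏ j ∈ I, r j) * ∏ j ∈ J, r j = (∏ j ∈ I ∩ J, r j ^ 2) * ∏ j ∈ symmDiff I J, r j := by
  rw [← Finset.prod_union_inter, Finset.prod_pow, sq, mul_assoc, symmDiff_eq_sup_sdiff_inf,
    Finset.sup_eq_union, Finset.inf_eq_inter, mul_comm (∏ j ∈ I ∩ J, r j) (∏ j ∈ _ \ _, r j),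
    Finset.prod_sdiff (Finset.inter_subset_left.trans Finset.subset_union_left), mul_comm]

section Multiquadratic

variable {F E ι : Type*} [Field F] [CommRing E] [Algebra F E] [Fintype ι] [DecidableEq ι]
  {a : ι → Fˣ} {r : ι → E} (b : Module.Basis (Finset ι) F E)

/-- Multiplication by b_I sends b_J to a scalar multiple of b_(I ∆ J). For nonempty I this differs
from b_J, so the matrix has zero diagonal. -/
theorem trace_basis_prod_eq_zero (hr : ∀ j, r j ^ 2 = algebraMap F E (a j))
    (hb : ∀ I, b I = ∏ j ∈ I, r j) {I : Finset ι} (hI : I.Nonempty) :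
    Algebra.trace F E (b I) = 0 := by
  rw [Algebra.trace_eq_matrix_trace b, Matrix.trace]
  refine Finset.sum_eq_zero fun J _ => ?_
  have hne : symmDiff I J ≠ J := fun h => hI.ne_empty (symmDiff_eq_right.mp h)
  rw [Matrix.diag_apply, Algebra.leftMulMatrix_eq_repr_mul, hb I, hb J, prod_mul_prod_eq_symmDiff,
    Finset.prod_congr rfl fun j _ => hr j, ← map_prod, ← Algebra.smul_def, ← hb, map_smul,
    Finsupp.smul_apply, b.repr_self, Finsupp.single_eq_of_ne hne.symm, smul_zero]

/-- The trace form of a multiquadratic algebra is diagonal in the basis of products of square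
roots. -/
theorem traceQuadraticForm_equivalent [NeZero (2 : F)]
    (hr : ∀ j, r j ^ 2 = algebraMap F E (a j)) (hb : ∀ I, b I = ∏ j ∈ I, r j) :
    QuadraticMap.Equivalent (traceQuadraticForm F E) (QuadraticMap.weightedSumSquares F
      fun I : Finset ι => Units.mk0 (2 : F) two_ne_zero ^ Fintype.card ι * ∏ j ∈ I, a j) := by
  -- The factor is the rank, the number of subsets of the index set; it is the origin of the scaling
  -- by 2^n.
  have htr : ∀ c : F, Algebra.trace F E (algebraMap F E c) = 2 ^ Fintype.card ι * c := by
    intro c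
    rw [Algebra.trace_algebraMap_of_basis b]
    simp
  have hinv : Invertible (2 : F) := invertibleOfNonzero two_ne_zero
  have hassoc : QuadraticMap.associated (traceQuadraticForm F E) = Algebra.traceForm F E :=
    QuadraticMap.associated_left_inverse F (Algebra.traceForm_isSymm F).eq
  have hortho : (QuadraticMap.associated (R := F) (traceQuadraticForm F E)).IsOrthoᵢ b := by
    intro I J hIJ
    rw [hassoc]
    change Algebra.traceForm F E (b I) (b J) = 0
    have hne : (symmDiff I J).Nonempty :=
      Finset.nonempty_iff_ne_empty.mpr fun h => hIJ (symmDiff_eq_bot.mp h)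
    rw [Algebra.traceForm_apply, hb I, hb J, prod_mul_prod_eq_symmDiff,
      Finset.prod_congr rfl fun j _ => hr j, ← map_prod, ← Algebra.smul_def, ← hb, map_smul,
      trace_basis_prod_eq_zero b hr hb hne, smul_zero]
  have hrepr := QuadraticMap.basisRepr_eq_of_iIsOrtho _ b hortho
  have hval : ∀ I, traceQuadraticForm F E (b I) =
      ((Units.mk0 (2 : F) two_ne_zero ^ Fintype.card ι * ∏ j ∈ I, a j : Fˣ) : F) := by
    intro I
    rw [traceQuadraticForm, LinearMap.BilinMap.toQuadraticMap_apply, Algebra.traceForm_apply, hb,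
      ← Finset.prod_mul_distrib, Finset.prod_congr rfl fun j _ => (pow_two (r j)).symm.trans (hr j),
      ← map_prod, htr]
    simp
  have heq : QuadraticMap.weightedSumSquares F (fun I => traceQuadraticForm F E (b I)) =
      QuadraticMap.weightedSumSquares F
      fun I : Finset ι => Units.mk0 (2 : F) two_ne_zero ^ Fintype.card ι * ∏ j ∈ I, a j := by
    ext x
    simp only [QuadraticMap.weightedSumSquares_apply, hval, Units.smul_def]
  rw [← heq, ← hrepr]
  exact ⟨QuadraticMap.isometryEquivBasisRepr _ b⟩

end Multiquadratic

/-! ### The basis of the generic multiquadratic field -/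

/-- The span is closed under multiplication and contains 1 and every ±r_j, hence the ring they
generate. As the generators are algebraic, that ring is already the field they generate. -/
theorem adjoin_sqrt_le_span_prod {F K ι : Type*} [Field F] [Field K] [Algebra F K]
    [DecidableEq ι] {a : ι → F} {r : ι → K} (hr : ∀ j, r j ^ 2 = algebraMap F K (a j)) {x : K}
    (hx : x ∈ IntermediateField.adjoin F {x : K | ∃ j, x ^ 2 = algebraMap F K (a j)}) :
    x ∈ Submodule.span F (Set.range fun I : Finset ι => ∏ j ∈ I, r j) := by
  have hmul : Submodule.span F (Set.range fun I : Finset ι => ∏ j ∈ I, r j) *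
      Submodule.span F (Set.range fun I : Finset ι => ∏ j ∈ I, r j) ≤
      Submodule.span F (Set.range fun I : Finset ι => ∏ j ∈ I, r j) := by
    rw [Submodule.span_mul_span, Submodule.span_le]
    rintro _ ⟨_, ⟨I, rfl⟩, _, ⟨J, rfl⟩, rfl⟩
    change (∏ j ∈ I, r j) * ∏ j ∈ J, r j ∈ Submodule.span F _
    rw [prod_mul_prod_eq_symmDiff, Finset.prod_congr rfl fun j _ => hr j, ← map_prod,
      ← Algebra.smul_def]
    exact Submodule.smul_mem _ _ (Submodule.subset_span (Set.mem_range_self _))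
  rw [← IntermediateField.mem_toSubalgebra,
    IntermediateField.adjoin_toSubalgebra_of_isAlgebraic] at hx
  · induction hx using Algebra.adjoin_induction with
    | mem x hx =>
      obtain ⟨j, hj⟩ := hx
      have hrj : r j ∈ Submodule.span F (Set.range fun I : Finset ι => ∏ j ∈ I, r j) :=
        Submodule.subset_span ⟨{j}, by simp⟩
      rcases sq_eq_sq_iff_eq_or_eq_neg.mp (hj.trans (hr j).symm) with rfl | rfl
      · exact hrj
      · exact neg_mem hrj
    | algebraMap c =>
      rw [Algebra.algebraMap_eq_smul_one]
      exact Submodule.smul_mem _ _ (Submodule.subset_span ⟨∅, by simp⟩)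
    | add x y _ _ hx hy => exact add_mem hx hy
    | mul x y _ _ hx hy => exact hmul (Submodule.mul_mem_mul hx hy)
  · rintro x ⟨j, hj⟩
    exact .of_pow two_pos (hj ▸ isAlgebraic_algebraMap (a j))

/-- The generic multiquadratic field has a basis of products of square roots of the variables. -/
theorem exists_basis_prod_sqrt (k : Type u) [Field k] (n : ℕ) :
    ∃ (r : Fin n → MultiquadraticField k n)
      (b : Module.Basis (Finset (Fin n)) (GenericField k n) (MultiquadraticField k n)),
      (∀ j, r j ^ 2 = algebraMap (GenericField k n) _ (coord k n j : GenericField k n)) ∧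
      ∀ I, b I = ∏ j ∈ I, r j := by
  have hex : ∀ j, ∃ x : AlgebraicClosure (GenericField k n), x ^ 2 =
      algebraMap (GenericField k n) _ (coord k n j : GenericField k n) :=
    fun j => IsAlgClosed.exists_pow_nat_eq _ two_pos
  choose r' hr' using hex
  let r : Fin n → MultiquadraticField k n := fun j =>
    ⟨r' j, IntermediateField.subset_adjoin _ _ ⟨j, hr' j⟩⟩
  have hr : ∀ j, r j ^ 2 = algebraMap (GenericField k n) _ (coord k n j : GenericField k n) :=
    fun j => Subtype.ext (hr' j)
  have hcoe : ∀ I : Finset (Fin n), ((∏ j ∈ I, r j : MultiquadraticField k n) :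
      AlgebraicClosure (GenericField k n)) = ∏ j ∈ I, r' j := fun I => by
    rw [← IntermediateField.coe_val, map_prod]; rfl
  have hli : LinearIndependent (GenericField k n) fun I : Finset (Fin n) => ∏ j ∈ I, r j := by
    refine LinearIndependent.of_comp (IntermediateField.val _).toLinearMap ?_
    convert! linearIndependent_prod_sqrt k n hr' using 1
    ext I
    exact hcoe I
  have hspan : ⊤ ≤ Submodule.span (GenericField k n)
      (Set.range fun I : Finset (Fin n) => ∏ j ∈ I, r j) := by
    rintro ⟨x, hx⟩ -
    have h := adjoin_sqrt_le_span_prod hr' hx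
    have hmap : (Submodule.span (GenericField k n)
        (Set.range fun I : Finset (Fin n) => ∏ j ∈ I, r j)).map
          (IntermediateField.val _).toLinearMap = Submodule.span (GenericField k n)
        (Set.range fun I : Finset (Fin n) => ∏ j ∈ I, r' j) := by
      rw [Submodule.map_span, ← Set.range_comp]
      congr 2
      ext I
      exact hcoe I
    rw [← hmap] at h
    obtain ⟨y, hy, hyx⟩ := h
    obtain rfl : y = ⟨x, hx⟩ := Subtype.ext hyx
    exact hy
  exact ⟨r, Module.Basis.mk hli hspan, hr, fun I => by simp⟩


/-! ### The generating polynomial of the subset products -/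

/-- Expand the product over subsets: the empty set gives e^m, cancelled modulo 2 by the added e^m,
and the full set gives the leading term. -/
theorem pow_mul_prod_add_eq_sum {R ι : Type*} [CommRing R] [Fintype ι] [DecidableEq ι]
    (h2 : (2 : R) = 0) (e : R) (x : ι → R) {m : ℕ} (hm : Fintype.card ι ≤ m)
    (hι : 0 < Fintype.card ι) :
    e ^ (m - Fintype.card ι) * ∏ j, (e + x j) + e ^ m =
      e ^ (m - Fintype.card ι) * ∏ j, x j +
        ∑ J : Finset ι with J.Nonempty ∧ J.card < Fintype.card ι,
          e ^ (m - J.card) * ∏ j ∈ J, x j := by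
  have hexp : e ^ (m - Fintype.card ι) * ∏ j, (e + x j) =
      ∑ J : Finset ι, e ^ (m - J.card) * ∏ j ∈ J, x j := by
    simp only [add_comm e, Fintype.prod_add, Finset.prod_const, Finset.mul_sum]
    refine Finset.sum_congr rfl fun J _ => ?_
    have hJ : m - J.card = (m - Fintype.card ι) + Jᶜ.card := by
      have := J.card_le_univ
      rw [Finset.card_compl]
      omega
    rw [hJ, pow_add]
    ring
  have hmem : ∀ J : Finset ι, ¬ (J.Nonempty ∧ J.card < Fintype.card ι) ↔
      J = ∅ ∨ J = Finset.univ := by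
    intro J
    rw [← Finset.card_eq_iff_eq_univ, ← Finset.not_nonempty_iff_eq_empty]
    have := J.card_le_univ
    grind
  -- Positivity of the cardinality keeps the two exceptional subsets distinct.
  have hne : (∅ : Finset ι) ≠ Finset.univ := by
    intro h
    rw [← Finset.card_univ, ← h, Finset.card_empty] at hι
    exact hι.false
  rw [hexp, ← Finset.sum_filter_add_sum_filter_not Finset.univ
    (fun J : Finset ι => J.Nonempty ∧ J.card < Fintype.card ι)]
  have hpair : (Finset.univ.filter fun J : Finset ι =>
      ¬ (J.Nonempty ∧ J.card < Fintype.card ι)) = {∅, Finset.univ} := by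
    ext J
    simp [hmem]
  rw [hpair, Finset.sum_pair hne]
  simp only [Finset.card_empty, Nat.sub_zero, Finset.prod_empty, Finset.card_univ]
  linear_combination e ^ m * h2

theorem coeff_one_add_C_mul_X_pow {R : Type*} [CommRing R] (q : R) {m : ℕ} (hm : m ≠ 0) :
    (1 + Polynomial.C q * Polynomial.X ^ m).coeff 0 = 1 ∧
      (∀ i : ℕ, i ≠ 0 → i ≠ m → (1 + Polynomial.C q * Polynomial.X ^ m).coeff i = 0) ∧
      (1 + Polynomial.C q * Polynomial.X ^ m).coeff m = q := by
  simp only [Polynomial.coeff_add, Polynomial.coeff_C_mul_X_pow, Polynomial.coeff_one]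
  refine ⟨by simp [hm.symm], fun i h0 hi => by simp [h0, hi], by simp [hm]⟩

section Symbols

variable {F : Type u} [Field F]

theorem symb_prod {ι : Type*} (s : Finset ι) (a : ι → Fˣ) :
    symb (∏ j ∈ s, a j) = ∑ j ∈ s, symb (a j) := by
  classical
  induction s using Finset.induction_on with
  | empty => exact symb_one
  | insert j s hj ih => rw [Finset.prod_insert hj, Finset.sum_insert hj, symb_mul, ih]

theorem symb_pow (a : Fˣ) (n : ℕ) : symb (a ^ n) = n * symb a := by
  have := symb_prod (Finset.range n) fun _ => a
  simpa using this

/-- Substitute {-a} = ε + {a} in {a}{-a} = 0. This is the relation x² = e x required for the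
collapse of the product, with e = ε. -/
theorem symb_sq (a : Fˣ) : symb a ^ 2 = eps F * symb a := by
  have h := symb_mul_neg a
  rw [← neg_one_mul, symb_mul] at h
  rw [eps]
  linear_combination h - MilnorK2.add_self (symb (-1) * symb a)

/-- The generating polynomial of the classes of all subset products, scaled by a common factor. -/
theorem sigmaPoly_mul_prod {ι : Type*} [Fintype ι] [DecidableEq ι] [Nonempty ι] (z : Fˣ)
    (a : ι → Fˣ) :
    sigmaPoly (fun I : Finset ι => z * ∏ j ∈ I, a j) =
      (1 + Polynomial.C (symb z) * Polynomial.X) ^ 2 ^ Fintype.card ι +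
      (1 + Polynomial.C (symb z) * Polynomial.X) ^ 2 ^ (Fintype.card ι - 1) *
        Polynomial.C (eps F ^ (2 ^ (Fintype.card ι - 1) - Fintype.card ι) * ∏ j, symb (a j) +
          ∑ J : Finset ι with J.Nonempty ∧ J.card < Fintype.card ι,
            eps F ^ (2 ^ (Fintype.card ι - 1) - J.card) * ∏ j ∈ J, symb (a j)) *
        Polynomial.X ^ 2 ^ (Fintype.card ι - 1) := by
  have hcard := Fintype.card_pos (α := ι)
  have hle : Fintype.card ι ≤ 2 ^ (Fintype.card ι - 1) := by
    have := Nat.lt_two_pow_self (n := Fintype.card ι - 1)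
    omega
  have h2 : (2 : Polynomial (MilnorK2 F)) = 0 := by
    rw [← map_ofNat Polynomial.C, MilnorK2.two_eq_zero, map_zero]
  obtain ⟨q, hq, -, h⟩ := prod_powerset_add_sum_mul h2 (e := Polynomial.C (eps F))
    (x := fun j => Polynomial.C (symb (a j)))
    (fun j => by rw [← map_pow, symb_sq, map_mul]) Finset.univ Finset.univ_nonempty
  have hprod := h (1 + Polynomial.C (symb z) * Polynomial.X) Polynomial.X
  rw [← pow_mul_prod_add_eq_sum MilnorK2.two_eq_zero _ _ hle hcard]
  rw [Finset.card_univ] at hq hprod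
  rw [map_add, map_mul, map_pow, map_pow, map_prod]
  simp only [map_add]
  rw [← hq, ← hprod, Finset.powerset_univ, sigmaPoly]
  refine Finset.prod_congr rfl fun I _ => ?_
  rw [symb_mul, symb_prod, map_add, map_sum]
  ring

end Symbols

/-- The empty product contributes the factor 1 + {1} X = 1. -/
theorem sigmaPoly_subtype_nonempty {F ι : Type*} [Field F] [Fintype ι] (a : ι → Fˣ) :
    sigmaPoly (fun I : {I : Finset ι // I.Nonempty} => ∏ j ∈ I.1, a j) =
      sigmaPoly (fun I : Finset ι => ∏ j ∈ I, a j) := by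
  classical
  rw [sigmaPoly, sigmaPoly, ← Finset.prod_filter_of_ne (p := Finset.Nonempty)]
  · rw [Finset.prod_subtype (Finset.univ.filter Finset.Nonempty) (p := Finset.Nonempty)
      (by simp)]
  · intro I _ hI
    by_contra hne
    rw [Finset.not_nonempty_iff_eq_empty] at hne
    subst hne
    simp [symb_one] at hI

/-! ### Cancellation of the class of 2 -/

/-- The scaling by `{2 ^ n}` and the correction by `{2}` cancel. -/
theorem add_C_mul_derivative_eq {R : Type*} [CommRing R] (h2 : (2 : R) = 0) {t : R}
    (ht : t * t = 0) (q : R) {n : ℕ} (hn : n ≠ 0) {u : Polynomial R}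
    (hu : u = 1 + Polynomial.C (n * t) * Polynomial.X) :
    u ^ 2 ^ n + u ^ 2 ^ (n - 1) * Polynomial.C q * Polynomial.X ^ 2 ^ (n - 1) +
      Polynomial.C t * (Polynomial.derivative
        (u ^ 2 ^ n + u ^ 2 ^ (n - 1) * Polynomial.C q * Polynomial.X ^ 2 ^ (n - 1)) *
          Polynomial.X ^ 2) =
      1 + Polynomial.C q * Polynomial.X ^ 2 ^ (n - 1) := by
  have h2' := congrArg (Polynomial.C (R := R)) h2
  have ht' := congrArg (Polynomial.C (R := R)) ht
  rw [map_ofNat, map_zero] at h2'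
  rw [map_mul, map_zero] at ht'
  have huu : u ^ 2 = 1 := by
    rw [hu, map_mul, map_natCast]
    linear_combination (n : Polynomial R) * Polynomial.C t * Polynomial.X * h2' +
      (n : Polynomial R) ^ 2 * Polynomial.X ^ 2 * ht'
  match n, hn with
  -- Here u itself survives, as the exponent 2^(n-1) is 1. Its contribution t q X² is matched by the
  -- derivative term, and the two cancel modulo 2.
  | 1, _ =>
    rw [Nat.cast_one, one_mul] at hu
    rw [Nat.sub_self, pow_zero, pow_one, pow_one, pow_one, huu, hu]
    simp only [Polynomial.derivative_add, Polynomial.derivative_mul, Polynomial.derivative_one,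
      Polynomial.derivative_C, Polynomial.derivative_X]
    linear_combination Polynomial.C t * Polynomial.C q * Polynomial.X ^ 2 * h2' +
      2 * Polynomial.C q * Polynomial.X ^ 3 * ht'
  -- Both powers of u are now even powers, hence 1, and the derivative vanishes because 2^(n+1) = 0
  -- in R.
  | n + 2, _ =>
    have hpow : ∀ l : ℕ, u ^ 2 ^ (l + 1) = 1 := fun l => by
      rw [pow_succ, pow_mul', huu, one_pow]
    have hcast : ((2 ^ (n + 1) : ℕ) : R) = 0 := by
      rw [pow_succ, Nat.cast_mul, Nat.cast_ofNat, h2, mul_zero]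
    rw [show n + 2 - 1 = n + 1 from rfl, hpow, hpow, one_mul, Polynomial.derivative_add,
      Polynomial.derivative_one, Polynomial.derivative_C_mul_X_pow, hcast]
    simp

/-- The Galois-Stiefel-Whitney classes of a multiquadratic algebra have the generating polynomial
of the classes of the subset products. -/
theorem galoisSW_multiquadratic {F E ι : Type*} [Field F] [NeZero (2 : F)] [CommRing E]
    [Algebra F E] [Fintype ι] [DecidableEq ι] [Nonempty ι] {a : ι → Fˣ} {r : ι → E}
    (b : Module.Basis (Finset ι) F E) (hr : ∀ j, r j ^ 2 = algebraMap F E (a j))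
    (hb : ∀ I, b I = ∏ j ∈ I, r j) (i : ℕ) :
    galoisSW F E i = (sigmaPoly fun I : Finset ι => ∏ j ∈ I, a j).coeff i := by
  -- The instance z = 1 is the target polynomial; the trace form gives the instance z = 2^n.
  have hone := sigmaPoly_mul_prod 1 a
  simp only [one_mul, symb_one, map_zero, zero_mul, add_zero, one_pow] at hone
  rw [galoisSW_eq (traceQuadraticForm_equivalent b hr hb), sigmaPoly_mul_prod, hone]
  congr 1
  exact add_C_mul_derivative_eq MilnorK2.two_eq_zero symb_two_sq _ Fintype.card_ne_zero
    (by rw [symb_pow])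

end MultiquadraticSW

/-! ### The main theorem -/

open MultiquadraticSW in
theorem mainTheorem4 {k : Type*} [Field k] [NeZero (2 : k)] (n : ℕ) (hn : 1 ≤ n) :
    (sigma 0 (coordProducts k n) = 1 ∧
      (∀ i : ℕ, i ≠ 0 → i ≠ 2 ^ (n - 1) → sigma i (coordProducts k n) = 0) ∧
      sigma (2 ^ (n - 1)) (coordProducts k n) =
        eps (GenericField k n) ^ (2 ^ (n - 1) - n) * ∏ j : Fin n, symb (coord k n j) +
          ∑ J : Finset (Fin n) with J.Nonempty ∧ J.card < n,
            eps (GenericField k n) ^ (2 ^ (n - 1) - J.card) * ∏ j ∈ J, symb (coord k n j)) ∧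
    (galoisSW (GenericField k n) (MultiquadraticField k n) 0 = 1 ∧
      (∀ i : ℕ, i ≠ 0 → i ≠ 2 ^ (n - 1) →
        galoisSW (GenericField k n) (MultiquadraticField k n) i = 0) ∧
      galoisSW (GenericField k n) (MultiquadraticField k n) (2 ^ (n - 1)) =
        eps (GenericField k n) ^ (2 ^ (n - 1) - n) * ∏ j : Fin n, symb (coord k n j) +
          ∑ J : Finset (Fin n) with J.Nonempty ∧ J.card < n,
            eps (GenericField k n) ^ (2 ^ (n - 1) - J.card) * ∏ j ∈ J, symb (coord k n j)) := by
  have : Nonempty (Fin n) := ⟨⟨0, hn⟩⟩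
  -- With z = 1 the symbol {z} vanishes, so u = 1 and the polynomial is 1 + q X^(2^(n-1)).
  have hpoly := sigmaPoly_mul_prod 1 (coord k n)
  simp only [one_mul, symb_one, map_zero, zero_mul, add_zero, one_pow, Fintype.card_fin] at hpoly
  have hcoeff := coeff_one_add_C_mul_X_pow
    (eps (GenericField k n) ^ (2 ^ (n - 1) - n) * ∏ j : Fin n, symb (coord k n j) +
      ∑ J : Finset (Fin n) with J.Nonempty ∧ J.card < n,
        eps (GenericField k n) ^ (2 ^ (n - 1) - J.card) * ∏ j ∈ J, symb (coord k n j))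
    (pow_ne_zero (n - 1) two_ne_zero)
  rw [← hpoly] at hcoeff
  have hsigma : ∀ i, sigma i (coordProducts k n) =
      (sigmaPoly fun I : Finset (Fin n) => ∏ j ∈ I, coord k n j).coeff i := by
    intro i
    rw [← coeff_sigmaPoly, ← sigmaPoly_subtype_nonempty]
    rfl
  obtain ⟨r, b, hr, hb⟩ := exists_basis_prod_sqrt k n
  have hgalois := galoisSW_multiquadratic b hr hb
  simp only [hsigma, hgalois]
  exact ⟨hcoeff, hcoeff⟩
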